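/- There is an absolute constant $C$ such that the following holds. Let $G=(V,E)$ be a finite, connected, unweighted simple graph with at least two vertices and with diameter $D$, embedded in the plane, and let $\emptyset\ne S=\{s_1,\dots,s_\ell\}\subseteq V$ be a set of vertices lying consecutively on one face, i.e. $S$ is the set of vertices of a contiguous segment of the boundary walk of a face. For $v\in V$ let $\mathrm{tuple}_S(v)=(d_G(v,s_1),\dots,d_G(v,s_\ell))$ be its $S$-distance tuple. Then the number of distinct $S$-distance tuples, over all $v\in V$, is at most $C\,|S|^3\,D$. Moreover, all $S\times T$ distances can be encoded in $\widetilde O(|S|^3 D+|T|)$ bits, where $\widetilde O$ hides factors polylogarithmic in $n=|V|$: there are a decoding function $f$ and constants $C',k$ such that for every $n\ge 2$, every $G$ and $S$ as above with $V=\{0,\dots,n-1\}$, and every $T\subseteq V$, there is a bit string $\sigma$ of length at most $C'\,(|S|^3D+|T|)\,(\log n)^k$ with $f(\sigma,s,t)=d_G(s,t)$ for all $s\in S$, $t\in T$. -/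

import Mathlib

/-- A combinatorial embedding (rotation system) of a simple graph `G`: for every vertex, a cyclic
ordering of the darts (oriented edges) that leave it. `rot d` is the dart that follows `d` in the
clockwise order around the tail `d.fst` of `d`. -/
structure RotationSystem {V : Type*} (G : SimpleGraph V) where
  /-- the next dart around the same tail -/
  rot : Equiv.Perm G.Dart
  /-- `rot` does not change the tail -/
  rot_fst : ∀ d : G.Dart, (rot d).fst = d.fst
  /-- all darts with a given tail form one cycle of `rot` -/
  rot_cyclic : ∀ d e : G.Dart, d.fst = e.fst → rot.SameCycle d e

namespace RotationSystem

variable {V : Type*} {G : SimpleGraph V}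

/-- The reversal `(u, v) ↦ (v, u)` of darts. -/
def rev (G : SimpleGraph V) : Equiv.Perm G.Dart :=
  Function.Involutive.toPerm SimpleGraph.Dart.symm SimpleGraph.Dart.symm_involutive

/-- The face permutation: after the dart `(u, v)`, the boundary walk of the face on its side
continues with the dart that follows `(v, u)` in the order around `v`. -/
def faceNext (R : RotationSystem G) : Equiv.Perm G.Dart :=
  (rev G).trans R.rot

/-- The faces: the orbits of the face permutation. -/
def Face (R : RotationSystem G) : Type _ :=
  Quotient (Equiv.Perm.SameCycle.setoid R.faceNext)

/-- A rotation system of a finite connected graph with at least one edge is planar (it is the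
rotation system of a drawing in the plane without crossings) if it has genus `0`, which is Euler's
formula `|V| - |E| + |F| = 2`. -/
def IsPlanar (R : RotationSystem G) : Prop :=
  Nat.card V + Nat.card R.Face = Nat.card G.edgeSet + 2

/-- The set `S` lies consecutively on a face: `S` is the set of vertices on a contiguous segment
of the boundary walk of a face. The segment consists of `ℓ` steps, beginning at the tail of `d`.
The boundary walk of a face need not be a simple cycle, so that the segment may visit a
vertex more than once. -/
def ConsecutiveOnFace (R : RotationSystem G) (S : Finset V) : Prop :=
  ∃ (d : G.Dart) (ℓ : ℕ), ∀ v : V, v ∈ S ↔ ∃ i < ℓ, ((R.faceNext ^ i) d).fst = v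

end RotationSystem

/-- The `S`-distance tuple of `v`: the distances from `v` to the vertices of `S`, as a tuple
indexed by the elements of `S`. -/
noncomputable def distTuple {V : Type*} (G : SimpleGraph V) (S : Finset V) (v : V) :
    {s : V // s ∈ S} → ℕ :=
  fun s => G.dist s.1 v

/-!
For two vertices `u` and `w`, consider the function `h x = d(u, x) - d(w, x)`. Its sublevel sets
and their complements are weighted Voronoi cells of `u` and of `w`, so they contain shortest paths
to the respective center and are connected. Two disjoint connected sets cannot alternate on the
boundary walk of a face of a planar graph. Hence `h` is cyclically unimodal along a face: each of
its sublevel sets is a cyclic interval (`RotationSystem.IsPlanar.nonAlternating_dist_sub_dist`).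

The topological ingredient `RotationSystem.IsPlanar.exists_mem_support_of_alternating` is derived
from Euler's formula by linear algebra over `ZMod 2`. Face boundaries are cycles, and Euler's
formula makes the dimensions agree, so that every cycle is the boundary of a set of faces. A walk
between two vertices of a face is closed up by a stretch of the boundary walk of the face. The
resulting cycle has two sides. After the face is split by a chord, the side of a dart changes only
across edges of the walk and at its two ends, so a disjoint walk stays on one side.

Both parts of the theorem follow from unimodality.

* Counting. Every vertex of `S` other than the starting point is adjacent to the one that the
  boundary walk visits just before it for the first time, so the distances from `v` to the two
  differ by `-1`, `0` or `1`. Comparing these differences with the thresholds `-1` and `0` encodes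
  `v` as a subset of a set with `2 |S|` elements. If four thresholds were shattered, there would be
  two vertices whose distance difference descends, ascends, descends and ascends along the face,
  against unimodality. By the Sauer-Shelah lemma there are `O(|S| ^ 3)` such subsets, and the
  subset together with the distance to the starting point determines the tuple.
* Encoding. The distance tuples form a tree, each edge of which joins the tuples of two adjacent
  vertices of the graph. For adjacent vertices `h` takes its values in `{-1, 0, 1}`, so it is given on
  `S` by two cyclic intervals, that is by `O(log n)` bits. The code consists of the positions
  of the elements of `S` on the face, the tuple at the root, for every tuple a
  pointer to its parent and the difference to it, and for every element of `T` a pointer to its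
  tuple.
-/

/-! ### Mod 2 homology of a planar rotation system -/

namespace SimpleGraph

variable {V : Type*} {G : SimpleGraph V}

lemma chain_add_self {α : Type*} (f : α → ZMod 2) : f + f = 0 :=
  funext fun _ => CharTwo.add_self_eq_zero _

/-- The edge underlying a dart, as an element of the edge set. -/
def Dart.toEdge (d : G.Dart) : G.edgeSet := ⟨d.edge, d.edge_mem⟩

lemma Dart.toEdge_symm (d : G.Dart) : d.symm.toEdge = d.toEdge :=
  Subtype.ext d.edge_symm

lemma exists_dart_toEdge (e : G.edgeSet) : ∃ d : G.Dart, d.toEdge = e := by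
  obtain ⟨e, he⟩ := e
  induction e with
  | _ u v => exact ⟨⟨(u, v), he⟩, rfl⟩

/-- The mod `2` boundary map, from edge chains to vertex chains. The coefficient at `v` is the sum
over the darts that leave `v`. -/
def edgeBoundary [Fintype G.Dart] [DecidableEq V] :
    (G.edgeSet → ZMod 2) →ₗ[ZMod 2] (V → ZMod 2) where
  toFun z v := ∑ d : G.Dart, if d.fst = v then z d.toEdge else 0
  map_add' z w := by
    ext v
    simp only [Pi.add_apply, ← Finset.sum_add_distrib]
    exact Finset.sum_congr rfl fun d _ => by split_ifs <;> simp
  map_smul' c z := by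
    ext v
    simp [Finset.mul_sum]

lemma edgeBoundary_apply [Fintype G.Dart] [DecidableEq V] (z : G.edgeSet → ZMod 2) (v : V) :
    edgeBoundary z v = ∑ d : G.Dart, if d.fst = v then z d.toEdge else 0 := rfl

/-- The edge chain obtained from a function on darts by adding its values at the two darts of an
edge. -/
noncomputable def edgeSum : (G.Dart → ZMod 2) →ₗ[ZMod 2] (G.edgeSet → ZMod 2) where
  toFun χ e := χ (exists_dart_toEdge e).choose + χ (exists_dart_toEdge e).choose.symm
  map_add' χ χ' := by ext e; simp only [Pi.add_apply]; ring
  map_smul' c χ := by ext e; simp [mul_add]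

lemma edgeSum_toEdge (χ : G.Dart → ZMod 2) (d : G.Dart) :
    edgeSum χ d.toEdge = χ d + χ d.symm := by
  have h := (exists_dart_toEdge d.toEdge).choose_spec
  change χ (exists_dart_toEdge d.toEdge).choose + χ (exists_dart_toEdge d.toEdge).choose.symm = _
  rcases (dart_edge_eq_iff _ _).1 (congrArg Subtype.val h) with h | h
  · rw [h]
  · rw [h, Dart.symm_symm, add_comm]

lemma edgeBoundary_single [Fintype G.Dart] [DecidableEq V] [DecidableEq G.edgeSet] (d : G.Dart) :
    edgeBoundary (Pi.single d.toEdge 1) = Pi.single d.fst 1 + Pi.single d.snd (1 : ZMod 2) := by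
  classical
  ext v
  have key : ∀ e : G.Dart, (if e.fst = v then (Pi.single d.toEdge 1 : G.edgeSet → ZMod 2) e.toEdge
      else 0) = (if e = d then (if d.fst = v then 1 else 0) else 0)
        + (if e = d.symm then (if d.snd = v then 1 else 0) else 0) := by
    intro e
    by_cases h1 : e = d
    · subst h1
      simp [(Dart.symm_ne e).symm]
    by_cases h2 : e = d.symm
    · subst h2
      simp [Dart.toEdge_symm, Dart.symm_ne d]
    have : e.toEdge ≠ d.toEdge := fun h => by
      rcases (dart_edge_eq_iff _ _).1 (congrArg Subtype.val h) with h | h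
      · exact h1 h
      · exact h2 h
    simp [h1, h2, this]
  rw [edgeBoundary_apply, Finset.sum_congr rfl fun e _ => key e, Finset.sum_add_distrib]
  simp [Pi.single_apply, eq_comm]

/-- A walk carries an edge chain whose boundary consists of the two ends of the walk. -/
lemma Walk.exists_edgeBoundary_eq [Fintype G.Dart] [DecidableEq V] {u v : V} (p : G.Walk u v) :
    ∃ z : G.edgeSet → ZMod 2, edgeBoundary z = Pi.single u 1 + Pi.single v 1 ∧
      ∀ e, z e ≠ 0 → e.1 ∈ p.edges := by
  classical
  induction p with
  | nil => exact ⟨0, by rw [map_zero, chain_add_self], fun e h => absurd rfl h⟩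
  | @cons u v w h p ih =>
    obtain ⟨z, hz, hz'⟩ := ih
    refine ⟨Pi.single (Dart.toEdge ⟨(u, v), h⟩) 1 + z, ?_, ?_⟩
    · rw [map_add, edgeBoundary_single, hz]
      change Pi.single u 1 + Pi.single v 1 + (Pi.single v 1 + Pi.single w 1) = _
      rw [add_assoc, ← add_assoc (Pi.single v 1), chain_add_self, zero_add]
    · intro e he
      rw [Walk.edges_cons, List.mem_cons]
      by_cases h' : e = Dart.toEdge ⟨(u, v), h⟩
      · left; rw [h']; rfl
      · right
        refine hz' e ?_
        simpa [h'] using he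

/-- In a connected graph the boundary map has corank at most one. -/
lemma Connected.card_le_finrank_range_edgeBoundary [Fintype V] [Fintype G.Dart] [DecidableEq V]
    (hG : G.Connected) :
    Fintype.card V ≤
      Module.finrank (ZMod 2) (LinearMap.range (edgeBoundary (G := G))) + 1 := by
  obtain ⟨r⟩ := hG.nonempty
  have htop : LinearMap.range (edgeBoundary (G := G)) ⊔
      Submodule.span (ZMod 2) {(Pi.single r 1 : V → ZMod 2)} = ⊤ := by
    rw [eq_top_iff, ← (Pi.basisFun (ZMod 2) V).span_eq, Submodule.span_le]
    rintro _ ⟨v, rfl⟩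
    obtain ⟨p⟩ := hG.preconnected v r
    obtain ⟨z, hz, -⟩ := p.exists_edgeBoundary_eq
    have : (Pi.basisFun (ZMod 2) V) v = edgeBoundary z + Pi.single r 1 := by
      rw [hz, add_assoc, chain_add_self, add_zero, Pi.basisFun_apply]
    rw [this]
    exact Submodule.add_mem_sup ⟨z, rfl⟩ (Submodule.mem_span_singleton_self _)
  have h1 := Submodule.finrank_add_le_finrank_add_finrank
    (LinearMap.range (edgeBoundary (G := G)))
    (Submodule.span (ZMod 2) {(Pi.single r 1 : V → ZMod 2)})
  rw [htop, finrank_top, Module.finrank_fintype_fun_eq_card] at h1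
  have h2 := finrank_span_le_card (R := ZMod 2) ({Pi.single r 1} : Set (V → ZMod 2))
  simp only [Set.toFinset_singleton, Finset.card_singleton] at h2
  omega

end SimpleGraph

namespace RotationSystem

open SimpleGraph

variable {V : Type*} {G : SimpleGraph V}

lemma faceNext_symm_rot (R : RotationSystem G) (d : G.Dart) :
    R.faceNext.symm (R.rot d) = d.symm := by
  rw [Equiv.symm_apply_eq]
  change R.rot d = R.rot d.symm.symm
  rw [Dart.symm_symm]

lemma edgeBoundary_edgeSum (R : RotationSystem G) [Fintype G.Dart] [DecidableEq V]
    (χ : G.Dart → ZMod 2) (v : V) :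
    edgeBoundary (edgeSum χ) v =
      ∑ d : G.Dart, if d.fst = v then χ d + χ (R.faceNext.symm d) else 0 := by
  have h : ∀ f : G.Dart → ZMod 2, ∑ d : G.Dart, (if d.fst = v then f d else 0) =
      ∑ d : G.Dart, if d.fst = v then f (R.rot d) else 0 := fun f => by
    rw [← Equiv.sum_comp R.rot]
    simp only [R.rot_fst]
  have hadd : ∀ f g : G.Dart → ZMod 2, ∑ d : G.Dart, (if d.fst = v then f d + g d else 0) =
      ∑ d : G.Dart, (if d.fst = v then f d else 0) +
        ∑ d : G.Dart, (if d.fst = v then g d else 0) := fun f g => by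
    rw [← Finset.sum_add_distrib]
    exact Finset.sum_congr rfl fun d _ => by split_ifs <;> simp
  simp only [edgeBoundary_apply, edgeSum_toEdge]
  rw [hadd, hadd, h fun d => χ (R.faceNext.symm d)]
  simp only [faceNext_symm_rot]

/-- The face on whose boundary walk a dart lies. -/
def faceOf (R : RotationSystem G) (d : G.Dart) : R.Face := Quotient.mk _ d

lemma faceOf_eq_of_sameCycle (R : RotationSystem G) {d e : G.Dart} (h : R.faceNext.SameCycle d e) :
    R.faceOf d = R.faceOf e := Quotient.sound h

lemma faceOf_faceNext (R : RotationSystem G) (d : G.Dart) :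
    R.faceOf (R.faceNext d) = R.faceOf d :=
  (R.faceOf_eq_of_sameCycle (Equiv.Perm.SameCycle.refl _ _ |>.apply_right)).symm

lemma faceOf_faceNext_symm (R : RotationSystem G) (d : G.Dart) :
    R.faceOf (R.faceNext.symm d) = R.faceOf d := by
  rw [← R.faceOf_faceNext, Equiv.apply_symm_apply]

/-- The mod `2` boundary map from face chains to edge chains. -/
noncomputable def faceBoundary (R : RotationSystem G) :
    (R.Face → ZMod 2) →ₗ[ZMod 2] (G.edgeSet → ZMod 2) :=
  edgeSum.comp (LinearMap.funLeft (ZMod 2) (ZMod 2) R.faceOf)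

lemma faceBoundary_toEdge (R : RotationSystem G) (φ : R.Face → ZMod 2) (d : G.Dart) :
    R.faceBoundary φ d.toEdge = φ (R.faceOf d) + φ (R.faceOf d.symm) :=
  edgeSum_toEdge _ d

lemma edgeBoundary_faceBoundary (R : RotationSystem G) [Fintype G.Dart] [DecidableEq V]
    (φ : R.Face → ZMod 2) : edgeBoundary (R.faceBoundary φ) = 0 := by
  ext v
  change edgeBoundary (edgeSum fun d => φ (R.faceOf d)) v = 0
  rw [R.edgeBoundary_edgeSum]
  simp [faceOf_faceNext_symm, CharTwo.add_self_eq_zero]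

/-- A function on darts that is invariant under rotation around the vertices of `P` and under
reversal of the edges inside `P` is constant along the walks in `P`. -/
lemma eq_of_walk [Finite V] (R : RotationSystem G) {α : Type*} (f : G.Dart → α) (P : Set V)
    (hrot : ∀ d, d.fst ∈ P → f (R.rot d) = f d)
    (hsymm : ∀ d : G.Dart, d.fst ∈ P → d.snd ∈ P → f d.symm = f d) {u v : V} (q : G.Walk u v) :
    (∀ x ∈ q.support, x ∈ P) → ∀ d e : G.Dart, d.fst = u → e.fst = v → f d = f e := by
  have hcyc : ∀ d e : G.Dart, d.fst ∈ P → d.fst = e.fst → f d = f e := by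
    intro d e hd h
    have hfin : Finite G.Dart := Finite.of_injective _ Dart.toProd_injective
    obtain ⟨n, -, rfl⟩ := (R.rot_cyclic d e h).exists_pow_eq'
    have key : ∀ m : ℕ, ((R.rot ^ m) d).fst = d.fst ∧ f ((R.rot ^ m) d) = f d := fun m => by
      induction m with
      | zero => exact ⟨rfl, rfl⟩
      | succ m ih =>
        rw [pow_succ', Equiv.Perm.mul_apply, R.rot_fst, hrot _ (by rw [ih.1]; exact hd)]
        exact ih
    exact (key n).2.symm
  induction q with
  | nil => exact fun hq d e hd he => hcyc d e (hd ▸ hq _ (by simp)) (hd.trans he.symm)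
  | @cons u w v h q ih =>
    intro hq d e hd he
    rw [Walk.support_cons] at hq
    have hu : u ∈ P := hq _ (by simp)
    have hw : w ∈ P := hq _ (by simp)
    have h1 : f d = f ⟨(u, w), h⟩ := hcyc d _ (hd ▸ hu) hd
    have h2 := hsymm ⟨(u, w), h⟩ hu hw
    rw [h1, ← h2]
    exact ih (fun x hx => hq x (by simp [hx])) _ e rfl he

/-- In a connected graph, only the constant face chains have boundary zero. -/
lemma eq_const_of_faceBoundary_eq_zero [Finite V] (R : RotationSystem G) (hG : G.Connected)
    {φ : R.Face → ZMod 2} (hφ : R.faceBoundary φ = 0) (a b : R.Face) : φ a = φ b := by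
  have hsymm : ∀ d : G.Dart, φ (R.faceOf d.symm) = φ (R.faceOf d) := fun d => by
    have := R.faceBoundary_toEdge φ d
    rw [hφ, Pi.zero_apply] at this
    exact (CharTwo.add_eq_zero.1 this.symm).symm
  induction a using Quotient.inductionOn with | _ d =>
  induction b using Quotient.inductionOn with | _ e =>
  obtain ⟨q⟩ := hG.preconnected d.fst e.fst
  refine R.eq_of_walk (fun d => φ (R.faceOf d)) Set.univ (fun d _ => ?_) (fun d _ _ => hsymm d) q
    (fun _ _ => trivial) d e rfl rfl
  rw [← faceOf_faceNext_symm, faceNext_symm_rot, hsymm]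

/-- The first mod `2` homology of a planar rotation system vanishes: every edge cycle is the
boundary of a face chain. Euler's formula says that the two spaces have the same dimension. -/
lemma IsPlanar.exists_faceBoundary_eq [Finite V] [Fintype G.Dart] [DecidableEq V]
    {R : RotationSystem G} (hR : R.IsPlanar) (hG : G.Connected) {z : G.edgeSet → ZMod 2}
    (hz : edgeBoundary z = 0) : ∃ φ, R.faceBoundary φ = z := by
  classical
  have := Fintype.ofFinite V
  have : Finite R.Face := Quotient.finite _
  have := Fintype.ofFinite R.Face
  have := Fintype.ofFinite G.edgeSet
  have hle : LinearMap.range R.faceBoundary ≤ LinearMap.ker (edgeBoundary (G := G)) := by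
    rintro _ ⟨φ, rfl⟩
    exact R.edgeBoundary_faceBoundary φ
  have h1 := (edgeBoundary (G := G)).finrank_range_add_finrank_ker
  have h2 := R.faceBoundary.finrank_range_add_finrank_ker
  rw [Module.finrank_fintype_fun_eq_card] at h1 h2
  have h3 := hG.card_le_finrank_range_edgeBoundary
  have h4 : Module.finrank (ZMod 2) (LinearMap.ker R.faceBoundary) ≤ 1 := by
    have hker : LinearMap.ker R.faceBoundary ≤
        Submodule.span (ZMod 2) {(fun _ => 1 : R.Face → ZMod 2)} := by
      intro φ hφ
      rw [Submodule.mem_span_singleton]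
      rcases isEmpty_or_nonempty R.Face with h | ⟨⟨a⟩⟩
      · exact ⟨0, funext fun b => h.elim b⟩
      · refine ⟨φ a, funext fun b => ?_⟩
        simpa using R.eq_const_of_faceBoundary_eq_zero hG hφ a b
    refine (Submodule.finrank_mono hker).trans ((finrank_span_le_card _).trans ?_)
    simp
  have h5 := hR
  rw [IsPlanar, Nat.card_eq_fintype_card, Nat.card_eq_fintype_card,
    Nat.card_eq_fintype_card] at h5
  have heq := Submodule.eq_of_le_of_finrank_le hle (by omega)
  have hz' : z ∈ LinearMap.ker (edgeBoundary (G := G)) := hz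
  rwa [← heq] at hz'

/-! ### Crossing walks between points of a face -/

/-- The vertex visited at time `t` by the boundary walk of the face that starts with the
dart `d`. -/
def faceWalk (R : RotationSystem G) (d : G.Dart) (t : ℕ) : V := ((R.faceNext ^ t) d).fst

lemma faceNext_pow_succ (R : RotationSystem G) (d : G.Dart) (t : ℕ) :
    (R.faceNext ^ (t + 1)) d = R.faceNext ((R.faceNext ^ t) d) := by
  rw [pow_succ', Equiv.Perm.mul_apply]

lemma faceNext_pow_injOn (R : RotationSystem G) (d : G.Dart) :
    Set.InjOn (fun t => (R.faceNext ^ t) d) (Set.Iio (Function.minimalPeriod R.faceNext d)) := by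
  have := Function.iterate_injOn_Iio_minimalPeriod (f := R.faceNext) (x := d)
  simpa only [Equiv.Perm.iterate_eq_pow] using this

/-- The Jordan curve argument. If two pairs of times alternate on the boundary walk of a face of a
planar rotation system, then a walk that joins the vertices of the first pair meets every walk that
joins the vertices of the second pair. -/
theorem IsPlanar.exists_mem_support_of_alternating [Finite V] {R : RotationSystem G}
    (hR : R.IsPlanar) (hG : G.Connected) (d : G.Dart) {i j k l : ℕ} (hij : i < j) (hjk : j < k)
    (hkl : k < l) (hl : l < Function.minimalPeriod R.faceNext d)
    (p : G.Walk (R.faceWalk d i) (R.faceWalk d k)) (q : G.Walk (R.faceWalk d j) (R.faceWalk d l)) :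
    ∃ v ∈ p.support, v ∈ q.support := by
  classical
  have : Finite G.Dart := Finite.of_injective _ Dart.toProd_injective
  have := Fintype.ofFinite G.Dart
  by_contra! hdisj
  obtain ⟨z, hz, hzp⟩ := p.exists_edgeBoundary_eq
  set D : ℕ → G.Dart := fun t => (R.faceNext ^ t) d with hD
  have hinj : ∀ s t, s ≤ l → t ≤ l → D s = D t → s = t := fun s t hs ht h =>
    R.faceNext_pow_injOn d (Set.mem_Iio.2 (by omega)) (Set.mem_Iio.2 (by omega)) h
  -- the stretch of the boundary walk from time `i` to time `k`, which closes `p` up to a cycle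
  set χ : G.Dart → ZMod 2 := ∑ t ∈ Finset.Ico i k, Pi.single (D t) 1 with hχ
  have hχ_step : ∀ e, χ e + χ (R.faceNext.symm e) =
      (Pi.single (D i) 1 : G.Dart → ZMod 2) e + (Pi.single (D k) 1 : G.Dart → ZMod 2) e := by
    intro e
    have hshift : χ (R.faceNext.symm e) =
        ∑ t ∈ Finset.Ico i k, (Pi.single (D (t + 1)) 1 : G.Dart → ZMod 2) e := by
      rw [hχ, Finset.sum_apply]
      refine Finset.sum_congr rfl fun t _ => ?_
      simp only [Pi.single_apply, Equiv.symm_apply_eq, hD, faceNext_pow_succ]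
    rw [hshift, hχ, Finset.sum_apply, ← CharTwo.sub_eq_add, ← Finset.sum_sub_distrib]
    have := Finset.sum_Ico_sub (fun t => (Pi.single (D t) 1 : G.Dart → ZMod 2) e)
      (hij.trans hjk).le
    rw [← CharTwo.sub_eq_add ((Pi.single (D i) 1 : G.Dart → ZMod 2) e),
      CharTwo.sub_eq_add, add_comm, ← CharTwo.sub_eq_add, ← this]
    exact Finset.sum_congr rfl fun t _ => by rw [CharTwo.sub_eq_add, CharTwo.sub_eq_add, add_comm]
  have hcycle : edgeBoundary (z + edgeSum χ) = 0 := by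
    have hb : edgeBoundary (edgeSum χ) =
        Pi.single (R.faceWalk d i) 1 + Pi.single (R.faceWalk d k) 1 := by
      ext v
      rw [R.edgeBoundary_edgeSum]
      simp only [hχ_step]
      have : ∀ t, ∑ e : G.Dart, (if e.fst = v then (Pi.single (D t) 1 : G.Dart → ZMod 2) e else 0)
          = (Pi.single (R.faceWalk d t) 1 : V → ZMod 2) v := fun t => by
        simp only [Pi.single_apply, ← ite_and, and_comm (a := _ = v)]
        simp only [ite_and, Finset.sum_ite_eq', Finset.mem_univ, if_true]
        simp only [faceWalk, hD, eq_comm]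
        congr
      rw [Pi.add_apply, ← this, ← this, ← Finset.sum_add_distrib]
      exact Finset.sum_congr rfl fun d _ => by split_ifs <;> simp
    rw [map_add, hz, hb, chain_add_self]
  obtain ⟨φ, hφ⟩ := hR.exists_faceBoundary_eq hG hcycle
  -- the two-coloring of the sides of the cycle, after a chord from `i` to `k` splits the face
  set ψ : G.Dart → ZMod 2 := fun e => φ (R.faceOf e) + χ e with hψ
  have hψ_symm : ∀ e : G.Dart, ψ e + ψ e.symm = z e.toEdge := fun e => by
    have h := congrFun hφ e.toEdge
    rw [faceBoundary_toEdge, Pi.add_apply, edgeSum_toEdge] at h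
    have : ψ e + ψ e.symm = (φ (R.faceOf e) + φ (R.faceOf e.symm)) + (χ e + χ e.symm) := by
      simp only [hψ]; ring
    rw [this, h, add_assoc, CharTwo.add_self_eq_zero, add_zero]
  have hzero : ∀ e : G.Dart, e.fst ∉ p.support → ψ e.symm = ψ e := fun e he => by
    have : z e.toEdge = 0 := by
      by_contra h
      exact he (p.fst_mem_support_of_mem_edges (hzp _ h))
    rw [← hψ_symm] at this
    exact (CharTwo.add_eq_zero.1 this).symm
  have hconst := R.eq_of_walk ψ {v | v ∉ p.support} (fun e he => by
    have h1 : ψ (R.rot e) = ψ e.symm := by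
      have h := hχ_step (R.rot e)
      rw [faceNext_symm_rot] at h
      have hne : ∀ t, R.faceWalk d t ∈ p.support →
          (Pi.single (D t) 1 : G.Dart → ZMod 2) (R.rot e) = 0 := fun t ht => by
        rw [Pi.single_apply, if_neg]
        intro h'
        refine he ?_
        rw [← R.rot_fst, h']
        exact ht
      rw [hne i p.start_mem_support, hne k p.end_mem_support, add_zero] at h
      simp only [hψ]
      rw [CharTwo.add_eq_zero.1 h, ← faceOf_faceNext_symm, faceNext_symm_rot]
    rw [h1, hzero e he]) (fun e he _ => hzero e he) q
    (fun x hx hxp => hdisj x hxp hx) (D j) (D l) rfl rfl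
  have hχ_apply : ∀ s, s ≤ l → χ (D s) = if s ∈ Finset.Ico i k then 1 else 0 := fun s hs => by
    rw [hχ, Finset.sum_apply, ← Finset.sum_ite_eq (Finset.Ico i k) s fun _ => (1 : ZMod 2)]
    refine Finset.sum_congr rfl fun t ht => ?_
    rw [Pi.single_apply]
    have := Finset.mem_Ico.1 ht
    exact if_congr ⟨hinj _ _ hs (by omega), fun h => h ▸ rfl⟩ rfl rfl
  have hface : R.faceOf (D j) = R.faceOf (D l) :=
    R.faceOf_eq_of_sameCycle (by simp only [hD, Equiv.Perm.sameCycle_pow_left,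
      Equiv.Perm.sameCycle_pow_right]; exact Equiv.Perm.SameCycle.refl _ _)
  simp only [hψ] at hconst
  rw [hface, hχ_apply j (by omega), hχ_apply l le_rfl, if_pos (by simp; omega),
    if_neg (by simp; omega)] at hconst
  exact absurd (add_left_cancel hconst) (by decide)

end RotationSystem

/-! ### Distance differences along a face -/

/-- The truth values of `P` at the times below `N` do not alternate: there are no four times
`i < j < k < l` such that `P` has one value at `i` and `k`, and the other one at `j` and `l`.
In other words, the set of times at which `P` holds is a cyclic interval. -/
def NonAlternating (N : ℕ) (P : ℕ → Prop) : Prop :=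
  ∀ ⦃i j k l : ℕ⦄, i < j → j < k → k < l → l < N → (P i ↔ P k) → (P j ↔ P l) → (P i ↔ P j)

/-- A cyclic interval is an interval, or the complement of one. -/
lemma NonAlternating.exists_interval {N : ℕ} {P : ℕ → Prop} (hP : NonAlternating N P) :
    ∃ lo hi, lo ≤ N ∧ hi ≤ N ∧ ∀ t < N, (P t ↔ P 0) ↔ ¬ (lo ≤ t ∧ t < hi) := by
  classical
  by_cases h : ∃ t, t < N ∧ ¬ (P t ↔ P 0)
  · have hlo := Nat.find_spec h
    set lo := Nat.find h
    have hlo_min : ∀ t < lo, t < N → (P t ↔ P 0) := fun t ht htN => by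
      by_contra h'
      exact Nat.find_min h ht ⟨htN, h'⟩
    have hlo0 : 0 < lo := Nat.pos_of_ne_zero fun h0 => hlo.2 (by rw [h0])
    have hex : ∃ t, lo < t ∧ (t = N ∨ (P t ↔ P 0)) := ⟨N, hlo.1, Or.inl rfl⟩
    have hhi := Nat.find_spec hex
    have hhiN : Nat.find hex ≤ N := Nat.find_min' hex ⟨hlo.1, Or.inl rfl⟩
    set hi := Nat.find hex
    have hhi_min : ∀ t < hi, lo < t → t ≠ N ∧ ¬ (P t ↔ P 0) := fun t ht hlt => by
      have := Nat.find_min hex ht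
      push Not at this
      have := this hlt
      tauto
    refine ⟨lo, hi, hlo.1.le, hhiN, fun t ht => ⟨fun hPt hlt => ?_, fun hlt => ?_⟩⟩
    · rcases hlt.1.eq_or_lt with h1 | h1
      · exact hlo.2 (h1 ▸ hPt)
      · exact (hhi_min t hlt.2 h1).2 hPt
    · by_contra hPt
      have h1 : lo ≤ t := by
        by_contra h1
        exact hPt (hlo_min t (by omega) ht)
      have h2 : hi ≤ t := by
        by_contra h2
        exact hlt ⟨h1, by omega⟩
      have h3 : P hi ↔ P 0 := hhi.2.resolve_left (by omega)
      have h4 : hi ≠ t := fun h => hPt (h ▸ h3)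
      have h5 := hP hlo0 hhi.1 (lt_of_le_of_ne h2 h4) ht h3.symm
      have h6 := hlo.2
      tauto
  · push Not at h
    exact ⟨0, 0, by omega, by omega, fun t ht => by have := h t ht; simp; tauto⟩

/-- If all sublevel sets of an integer sequence are cyclic intervals, then the sequence cannot
descend, ascend, descend and ascend again at four successive times. -/
lemma not_descend_ascend_twice {N : ℕ} {H : ℕ → ℤ} (hH : ∀ τ, NonAlternating N fun t => H t ≤ τ)
    {a b c e : ℕ} (hab : a < b) (hbc : b < c) (hce : c < e) (he : e < N)
    (ha' : H a < H (a - 1)) (hb' : H (b - 1) < H b) (hc' : H c < H (c - 1))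
    (he' : H (e - 1) < H e) : False := by
  have pos : ∀ t, H t ≠ H (t - 1) → t - 1 < t := fun t h => by
    rcases Nat.eq_zero_or_pos t with rfl | h'
    · exact absurd rfl h
    · omega
  have pa := pos a ha'.ne
  have pb := pos b hb'.ne'
  have pc := pos c hc'.ne
  have pe := pos e he'.ne'
  -- a peak between `b` and `c`, and a valley on either side of it
  obtain ⟨m, hm1, hm2, hmb, hmc⟩ : ∃ m, b ≤ m ∧ m ≤ c - 1 ∧ H b ≤ H m ∧ H (c - 1) ≤ H m := by
    rcases le_total (H b) (H (c - 1)) with h | h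
    · exact ⟨c - 1, by omega, le_rfl, h, le_rfl⟩
    · exact ⟨b, le_rfl, by omega, le_rfl, h⟩
  obtain ⟨x, hx1, hx2, hxa, hxb⟩ : ∃ x, a ≤ x ∧ x ≤ b - 1 ∧ H x ≤ H a ∧ H x ≤ H (b - 1) := by
    rcases le_total (H a) (H (b - 1)) with h | h
    · exact ⟨a, le_rfl, by omega, le_rfl, h⟩
    · exact ⟨b - 1, by omega, le_rfl, h, le_rfl⟩
  obtain ⟨y, hy1, hy2, hyc, hye⟩ : ∃ y, c ≤ y ∧ y ≤ e - 1 ∧ H y ≤ H c ∧ H y ≤ H (e - 1) := by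
    rcases le_total (H c) (H (e - 1)) with h | h
    · exact ⟨c, le_rfl, by omega, le_rfl, h⟩
    · exact ⟨e - 1, by omega, le_rfl, h, le_rfl⟩
  -- at the level of the higher valley, the two valleys alternate with the peak `m` and the outer
  -- peak on the side of the higher valley
  rcases le_total (H y) (H x) with h | h
  · have := hH (H x) (show a - 1 < x by omega) (show x < m by omega) (show m < y by omega)
      (by omega) (iff_of_false (by omega) (by omega)) (iff_of_true le_rfl h)
    exact absurd (this.2 le_rfl) (by omega)
  · have := hH (H y) (show x < m by omega) (show m < y by omega) (show y < e by omega)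
      he (iff_of_true h le_rfl) (iff_of_false (by omega) (by omega))
    exact absurd (this.1 h) (by omega)

namespace SimpleGraph

variable {V : Type*} {G : SimpleGraph V}

/-- The set of vertices whose distances from `u` and from `w` differ by at most `τ` (a weighted
Voronoi cell of `u`) contains a shortest walk from `u` to each of its vertices. -/
lemma Connected.exists_walk_dist_sub_dist_le (hG : G.Connected) (u w : V) (τ : ℤ) {x : V}
    (hx : (G.dist u x : ℤ) - G.dist w x ≤ τ) :
    ∃ p : G.Walk u x, ∀ y ∈ p.support, (G.dist u y : ℤ) - G.dist w y ≤ τ := by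
  classical
  obtain ⟨p, hp⟩ := hG.exists_walk_length_eq_dist u x
  refine ⟨p, fun y hy => ?_⟩
  have h1 := dist_le (p.takeUntil y hy)
  have h2 := dist_le (p.dropUntil y hy)
  have h3 := congrArg Walk.length (p.take_spec hy)
  rw [Walk.length_append] at h3
  have h4 := hG.dist_triangle (u := w) (v := y) (w := x)
  omega

lemma Connected.exists_walk_of_dist_sub_dist_le (hG : G.Connected) (u w : V) (τ : ℤ) {x x' : V}
    (hx : (G.dist u x : ℤ) - G.dist w x ≤ τ) (hx' : (G.dist u x' : ℤ) - G.dist w x' ≤ τ) :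
    ∃ p : G.Walk x x', ∀ y ∈ p.support, (G.dist u y : ℤ) - G.dist w y ≤ τ := by
  obtain ⟨p, hp⟩ := hG.exists_walk_dist_sub_dist_le u w τ hx
  obtain ⟨p', hp'⟩ := hG.exists_walk_dist_sub_dist_le u w τ hx'
  refine ⟨p.reverse.append p', fun y hy => ?_⟩
  rw [Walk.mem_support_append_iff, Walk.support_reverse, List.mem_reverse] at hy
  exact hy.elim (hp y) (hp' y)

end SimpleGraph

namespace RotationSystem

open SimpleGraph

variable {V : Type*} {G : SimpleGraph V}

/-- On a face of a planar graph, the difference of the distances from two vertices is cyclically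
unimodal: its sublevel sets and their complements are Voronoi cells, hence connected, so that they
cannot alternate on the face. -/
theorem IsPlanar.nonAlternating_dist_sub_dist [Finite V] {R : RotationSystem G} (hR : R.IsPlanar)
    (hG : G.Connected) (d : G.Dart) (u w : V) (τ : ℤ) :
    NonAlternating (Function.minimalPeriod R.faceNext d)
      fun t => (G.dist u (R.faceWalk d t) : ℤ) - G.dist w (R.faceWalk d t) ≤ τ := by
  intro i j k l hij hjk hkl hl hik hjl
  by_contra hne
  have low := fun {x x' : V} => hG.exists_walk_of_dist_sub_dist_le u w τ (x := x) (x' := x')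
  have high := fun {x x' : V} =>
    hG.exists_walk_of_dist_sub_dist_le w u (-τ - 1) (x := x) (x' := x')
  by_cases hi : (G.dist u (R.faceWalk d i) : ℤ) - G.dist w (R.faceWalk d i) ≤ τ
  · have hj : ¬ (G.dist u (R.faceWalk d j) : ℤ) - G.dist w (R.faceWalk d j) ≤ τ := by tauto
    obtain ⟨p, hp⟩ := low hi (hik.1 hi)
    obtain ⟨q, hq⟩ := high (x := R.faceWalk d j) (x' := R.faceWalk d l) (by omega)
      (by have := mt hjl.2 hj; omega)
    obtain ⟨y, hyp, hyq⟩ := hR.exists_mem_support_of_alternating hG d hij hjk hkl hl p q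
    have := hp y hyp
    have := hq y hyq
    omega
  · have hj : (G.dist u (R.faceWalk d j) : ℤ) - G.dist w (R.faceWalk d j) ≤ τ := by tauto
    obtain ⟨q, hq⟩ := low hj (hjl.1 hj)
    obtain ⟨p, hp⟩ := high (x := R.faceWalk d i) (x' := R.faceWalk d k) (by omega)
      (by have := mt hik.2 hi; omega)
    obtain ⟨y, hyp, hyq⟩ := hR.exists_mem_support_of_alternating hG d hij hjk hkl hl p q
    have := hp y hyp
    have := hq y hyq
    omega

/-! ### Counting distance tuples -/

/-- The first time at which the boundary walk starting with the dart `d` visits `s`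
(and `0` if there is none). -/
noncomputable def firstVisit (R : RotationSystem G) (d : G.Dart) (s : V) : ℕ :=
  sInf {t | R.faceWalk d t = s}

lemma faceWalk_firstVisit (R : RotationSystem G) (d : G.Dart) {s : V}
    (hs : ∃ t, R.faceWalk d t = s) : R.faceWalk d (R.firstVisit d s) = s :=
  Nat.sInf_mem hs

lemma firstVisit_le (R : RotationSystem G) {d : G.Dart} {s : V} {t : ℕ}
    (ht : R.faceWalk d t = s) : R.firstVisit d s ≤ t :=
  Nat.sInf_le ht

lemma minimalPeriod_faceNext_pos [Finite V] (R : RotationSystem G) (d : G.Dart) :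
    0 < Function.minimalPeriod R.faceNext d := by
  have : Finite G.Dart := Finite.of_injective _ Dart.toProd_injective
  exact Function.minimalPeriod_pos_of_mem_periodicPts
    (R.faceNext.injective.mem_periodicPts d)

lemma firstVisit_lt [Finite V] (R : RotationSystem G) (d : G.Dart) {s : V}
    (hs : ∃ t, R.faceWalk d t = s) : R.firstVisit d s < Function.minimalPeriod R.faceNext d := by
  obtain ⟨t, ht⟩ := hs
  refine (R.firstVisit_le (t := t % Function.minimalPeriod R.faceNext d) ?_).trans_lt
    (Nat.mod_lt _ (R.minimalPeriod_faceNext_pos d))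
  rw [← ht, faceWalk, faceWalk, ← Equiv.Perm.iterate_eq_pow, ← Equiv.Perm.iterate_eq_pow,
    Function.iterate_mod_minimalPeriod_eq]

lemma faceWalk_adj (R : RotationSystem G) (d : G.Dart) (t : ℕ) :
    G.Adj (R.faceWalk d t) (R.faceWalk d (t + 1)) := by
  have : R.faceWalk d (t + 1) = ((R.faceNext ^ t) d).snd := by
    rw [faceWalk, faceNext_pow_succ]
    exact R.rot_fst _
  rw [this]
  exact ((R.faceNext ^ t) d).adj

open Classical in
/-- The pattern of `v`: for every `s ∈ S`, the comparison of the distances from `v` to `s` and to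
the vertex that the boundary walk visits just before its first visit to `s`. The difference is
`-1`, `0` or `1`, and is recorded by its comparison with the thresholds `-1` and `0`. -/
noncomputable def distPattern (R : RotationSystem G) (d : G.Dart) (S : Finset V) (v : V) :
    Finset ({s // s ∈ S} × Bool) :=
  Finset.univ.filter fun x => (G.dist v x.1.1 : ℤ) -
    G.dist v (R.faceWalk d (R.firstVisit d x.1.1 - 1)) ≤ if x.2 then 0 else -1

lemma mem_distPattern (R : RotationSystem G) (d : G.Dart) (S : Finset V) (v : V)
    (x : {s // s ∈ S} × Bool) :
    x ∈ R.distPattern d S v ↔ (G.dist v x.1.1 : ℤ) -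
      G.dist v (R.faceWalk d (R.firstVisit d x.1.1 - 1)) ≤ if x.2 then 0 else -1 := by
  simp [distPattern]

/-- The pattern of `v`, together with one distance, determines all distances from `v` to the
vertices on the segment. -/
lemma dist_eq_of_distPattern_eq (R : RotationSystem G) (d : G.Dart) {S : Finset V} {ℓ : ℕ}
    (hS : ∀ t < ℓ, R.faceWalk d t ∈ S) {v v' : V}
    (hpat : R.distPattern d S v = R.distPattern d S v')
    (h0 : G.dist v (R.faceWalk d 0) = G.dist v' (R.faceWalk d 0)) (t : ℕ) (ht : t < ℓ) :
    G.dist v (R.faceWalk d t) = G.dist v' (R.faceWalk d t) := by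
  induction t using Nat.strong_induction_on with
  | _ t ih =>
    have hex : ∃ t', R.faceWalk d t' = R.faceWalk d t := ⟨t, rfl⟩
    rcases (R.firstVisit_le (rfl : R.faceWalk d t = _)).lt_or_eq with h | h
    · rw [← R.faceWalk_firstVisit d hex]
      exact ih _ h (h.trans ht)
    rcases t with _ | t
    · exact h0
    have hprev := ih t (by omega) (by omega)
    have hmem : ∀ b : Bool, _ := fun b => congrArg (fun A => (⟨_, hS _ ht⟩, b) ∈ A) hpat
    simp only [mem_distPattern, h, Nat.add_sub_cancel, eq_iff_iff] at hmem
    have h1 := (R.faceWalk_adj d t).diff_dist_adj (u := v)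
    have h2 := (R.faceWalk_adj d t).diff_dist_adj (u := v')
    have h3 := hmem true
    have h4 := hmem false
    simp only [if_true, Bool.false_eq_true, if_false] at h3 h4
    omega

open Classical in
/-- No four thresholds are shattered by the patterns. Otherwise, order them by time, and let `u` cut
out the first and the third one, and `w` the second and the fourth one: the difference of the
distances from `u` and `w` would descend, ascend, descend and ascend. -/
lemma IsPlanar.card_le_three_of_shatters [Fintype V] {R : RotationSystem G} (hR : R.IsPlanar)
    (hG : G.Connected) (d : G.Dart) {S : Finset V} (hS : ∀ s ∈ S, ∃ t, R.faceWalk d t = s)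
    {T : Finset ({s // s ∈ S} × Bool)}
    (hT : (Finset.univ.image (R.distPattern d S)).Shatters T) : T.card ≤ 3 := by
  by_contra! hcard
  obtain ⟨T', hT', hcard'⟩ := Finset.exists_subset_card_eq (show 4 ≤ T.card from hcard)
  replace hT := hT.mono_right hT'
  have hcut : ∀ A ⊆ T', ∃ v, ∀ x ∈ T', x ∈ R.distPattern d S v ↔ x ∈ A := fun A hA => by
    obtain ⟨B, hB, rfl⟩ := hT hA
    obtain ⟨v, -, rfl⟩ := Finset.mem_image.1 hB
    exact ⟨v, fun x hx => by simp [hx]⟩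
  set time : {s // s ∈ S} × Bool → ℕ := fun x => R.firstVisit d x.1.1 with htime
  have hinj : Set.InjOn time T' := by
    rintro ⟨s, b⟩ hx ⟨s', b'⟩ hy hxy
    have hss : s = s' := Subtype.ext (by
      rw [← R.faceWalk_firstVisit d (hS _ s.2), ← R.faceWalk_firstVisit d (hS _ s'.2)]
      exact congrArg _ hxy)
    subst hss
    by_contra hne
    -- the lower threshold cannot be cut out without the upper one
    have hmono : (s, false) ∈ T' → (s, true) ∈ T' → False := fun h h' => by
      obtain ⟨v, hv⟩ := hcut {(s, false)} (by simpa using h)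
      have h1 := (hv _ h).2 (by simp)
      have h2 := (hv _ h').not.2 (by simp)
      rw [mem_distPattern] at h1 h2
      simp only [if_true, Bool.false_eq_true, if_false] at h1 h2
      omega
    rcases b <;> rcases b'
    · exact hne rfl
    · exact hmono hx hy
    · exact hmono hy hx
    · exact hne rfl
  have hc : (T'.image time).card = 4 := by rw [Finset.card_image_of_injOn hinj, hcard']
  set o := (T'.image time).orderEmbOfFin hc
  have ho : ∀ i, ∃ x ∈ T', time x = o i := fun i =>
    Finset.mem_image.1 (Finset.orderEmbOfFin_mem _ hc i)
  choose x hxT hx using ho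
  have hxne : ∀ i j, i ≠ j → x i ≠ x j := fun i j hij h =>
    hij (o.injective (by rw [← hx, ← hx, h]))
  obtain ⟨u, hu⟩ := hcut {x 0, x 2} (by
    intro y hy
    rcases Finset.mem_insert.1 hy with rfl | hy
    · exact hxT _
    · rw [Finset.mem_singleton.1 hy]; exact hxT _)
  obtain ⟨w, hw⟩ := hcut {x 1, x 3} (by
    intro y hy
    rcases Finset.mem_insert.1 hy with rfl | hy
    · exact hxT _
    · rw [Finset.mem_singleton.1 hy]; exact hxT _)
  have hlt : ∀ i j, i < j → time (x i) < time (x j) := fun i j h => by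
    rw [hx, hx]; exact o.strictMono h
  -- a threshold that separates `a` from `b` witnesses a strict change of the distance difference
  have hsep : ∀ (a b : V) (y : {s // s ∈ S} × Bool), y ∈ R.distPattern d S a →
      y ∉ R.distPattern d S b →
      (G.dist a (R.faceWalk d (time y)) : ℤ) - G.dist b (R.faceWalk d (time y)) <
        G.dist a (R.faceWalk d (time y - 1)) - G.dist b (R.faceWalk d (time y - 1)) := by
    intro a b y ha hb
    rw [mem_distPattern] at ha hb
    simp only [htime, R.faceWalk_firstVisit d (hS _ y.1.2)]
    omega
  have mem : ∀ i, (x i ∈ R.distPattern d S u ↔ i = 0 ∨ i = 2) ∧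
      (x i ∈ R.distPattern d S w ↔ i = 1 ∨ i = 3) := fun i => by
    have hiff : ∀ j, x i = x j ↔ i = j := fun j =>
      ⟨fun h => by by_contra h'; exact hxne i j h' h, fun h => h ▸ rfl⟩
    rw [hu _ (hxT i), hw _ (hxT i)]
    simp only [Finset.mem_insert, Finset.mem_singleton, hiff, and_self]
  refine not_descend_ascend_twice
    (fun τ => hR.nonAlternating_dist_sub_dist hG d u w τ)
    (hlt 0 1 (by decide)) (hlt 1 2 (by decide)) (hlt 2 3 (by decide))
    (R.firstVisit_lt d (hS _ (x 3).1.2)) ?_ ?_ ?_ ?_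
  · exact hsep u w _ ((mem 0).1.2 (by decide)) ((mem 0).2.not.2 (by decide))
  · have := hsep w u _ ((mem 1).2.2 (by decide)) ((mem 1).1.not.2 (by decide))
    omega
  · exact hsep u w _ ((mem 2).1.2 (by decide)) ((mem 2).2.not.2 (by decide))
  · have := hsep w u _ ((mem 3).2.2 (by decide)) ((mem 3).1.not.2 (by decide))
    omega

open Classical in
lemma IsPlanar.card_image_distPattern_le [Fintype V] {R : RotationSystem G} (hR : R.IsPlanar)
    (hG : G.Connected) (d : G.Dart) {S : Finset V} (hS : ∀ s ∈ S, ∃ t, R.faceWalk d t = s)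
    (hne : S.Nonempty) : (Finset.univ.image (R.distPattern d S)).card ≤ 32 * S.card ^ 3 := by
  set 𝒜 := Finset.univ.image (R.distPattern d S)
  have hvc : 𝒜.vcDim ≤ 3 := Finset.sup_le fun T hT =>
    hR.card_le_three_of_shatters hG d hS (Finset.mem_shatterer.1 hT)
  have hcard : Fintype.card ({s // s ∈ S} × Bool) = 2 * S.card := by
    rw [Fintype.card_prod, Fintype.card_coe, Fintype.card_bool, mul_comm]
  have hpos := hne.card_pos
  calc 𝒜.card ≤ ∑ k ∈ Finset.Iic 𝒜.vcDim, (Fintype.card ({s // s ∈ S} × Bool)).choose k :=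
        (Finset.card_le_card_shatterer 𝒜).trans Finset.card_shatterer_le_sum_vcDim
    _ ≤ ∑ k ∈ Finset.Iic 3, (2 * S.card).choose k := by
        rw [hcard]
        exact Finset.sum_le_sum_of_subset (Finset.Iic_subset_Iic.2 hvc)
    _ ≤ ∑ _k ∈ Finset.Iic 3, (2 * S.card) ^ 3 := by
        refine Finset.sum_le_sum fun k hk => (Nat.choose_le_pow _ k).trans ?_
        exact Nat.pow_le_pow_right (by omega) (Finset.mem_Iic.1 hk)
    _ = 32 * S.card ^ 3 := by
        rw [Finset.sum_const, Nat.card_Iic, smul_eq_mul]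
        ring

/-- The number of distance tuples of a segment of a face is `O(|S| ^ 3 D)`. -/
theorem IsPlanar.ncard_range_distTuple_le [Finite V] [Nontrivial V] {R : RotationSystem G}
    (hR : R.IsPlanar) (hG : G.Connected) {S : Finset V} (hne : S.Nonempty)
    (hS : R.ConsecutiveOnFace S) :
    (Set.range (distTuple G S)).ncard ≤ 64 * S.card ^ 3 * G.diam := by
  classical
  have := Fintype.ofFinite V
  obtain ⟨d, ℓ, hℓ⟩ := hS
  have hvisit : ∀ s ∈ S, ∃ t, R.faceWalk d t = s := fun s hs => by
    obtain ⟨t, -, ht⟩ := (hℓ s).1 hs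
    exact ⟨t, ht⟩
  set key : V → Finset ({s // s ∈ S} × Bool) × ℕ :=
    fun v => (R.distPattern d S v, G.dist v (R.faceWalk d 0)) with hkey
  obtain ⟨g, hg⟩ : ∃ g, distTuple G S = g ∘ key := by
    refine Function.factorsThrough_iff _ |>.1 fun v v' h => ?_
    obtain ⟨h1, h2⟩ := Prod.mk.inj h
    ext ⟨s, hs⟩
    obtain ⟨t, ht, rfl⟩ := (hℓ s).1 hs
    change G.dist (R.faceWalk d t) v = G.dist (R.faceWalk d t) v'
    rw [dist_comm, R.dist_eq_of_distPattern_eq d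
      (fun t ht => (hℓ _).2 ⟨t, ht, rfl⟩) h1 h2 t ht, dist_comm]
  have hdiam := connected_iff_diam_ne_zero.1 hG
  have hsub : Set.range key ⊆
      ↑((Finset.univ.image (R.distPattern d S)) ×ˢ Finset.range (G.diam + 1)) := by
    rintro _ ⟨v, rfl⟩
    rw [Finset.mem_coe, Finset.mem_product]
    exact ⟨Finset.mem_image_of_mem _ (Finset.mem_univ v), Finset.mem_range.2
      (Nat.lt_succ_of_le (dist_le_diam (connected_iff_ediam_ne_top.1 hG)))⟩
  rw [hg, Set.range_comp]
  refine (Set.ncard_image_le (Set.toFinite _)).trans ((Set.ncard_le_ncard hsub).trans ?_)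
  rw [Set.ncard_coe_finset, Finset.card_product, Finset.card_range]
  calc _ ≤ (32 * S.card ^ 3) * (2 * G.diam) :=
        Nat.mul_le_mul (hR.card_image_distPattern_le hG d hvisit hne) (by omega)
    _ = _ := by ring

end RotationSystem

/-! ### Prefix codes -/

/-- A code is prefix-free if a concatenation that begins with a codeword determines this codeword
and the rest. -/
def IsPrefixCode {α : Type*} (f : α → List Bool) : Prop :=
  ∀ ⦃a b : α⦄ ⦃x y : List Bool⦄, f a ++ x = f b ++ y → a = b ∧ x = y

/-- The code of a list: every codeword is announced by the bit `true`, and the bit `false` ends the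
list. -/
def listCode {α : Type*} (f : α → List Bool) : List α → List Bool
  | [] => [false]
  | a :: l => true :: (f a ++ listCode f l)

lemma IsPrefixCode.listCode {α : Type*} {f : α → List Bool} (hf : IsPrefixCode f) :
    IsPrefixCode (listCode f) := by
  intro l
  induction l with
  | nil =>
    rintro (_ | ⟨b, m⟩) x y h
    · exact ⟨rfl, by simpa [_root_.listCode] using h⟩
    · simp [_root_.listCode] at h
  | cons a l ih =>
    rintro (_ | ⟨b, m⟩) x y h
    · simp [_root_.listCode] at h
    · simp only [_root_.listCode, List.cons_append, List.cons.injEq, true_and,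
        List.append_assoc] at h
      obtain ⟨rfl, h'⟩ := hf h
      obtain ⟨rfl, rfl⟩ := ih h'
      exact ⟨rfl, rfl⟩

lemma IsPrefixCode.injective {α : Type*} {f : α → List Bool} (hf : IsPrefixCode f) :
    Function.Injective f := fun a b h => (hf (x := []) (y := []) (by rw [h])).1

lemma length_listCode_le {α : Type*} {f : α → List Bool} {l : List α} {B : ℕ}
    (h : ∀ a ∈ l, (f a).length ≤ B) : (listCode f l).length ≤ 1 + l.length * (B + 1) := by
  induction l with
  | nil => simp [listCode]
  | cons a l ih =>
    have h1 := ih fun b hb => h b (List.mem_cons_of_mem _ hb)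
    have h2 := h a List.mem_cons_self
    simp only [listCode, List.length_cons, List.length_append, add_mul, one_mul] at h1 ⊢
    omega

/-- The code of a natural number: the code of its list of binary digits. -/
def natCode (n : ℕ) : List Bool := listCode (fun b : Bool => [b]) n.bits

lemma isPrefixCode_natCode : IsPrefixCode natCode := by
  intro a b x y h
  have hb : IsPrefixCode fun b : Bool => [b] := fun a b x y h => by simpa using h
  obtain ⟨h1, h2⟩ := hb.listCode h
  refine ⟨Nat.digits_inj_iff (b := 2).1 ?_, h2⟩
  rw [Nat.digits_two_eq_bits, Nat.digits_two_eq_bits, h1]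

lemma length_natCode_le (n : ℕ) : (natCode n).length ≤ 1 + n.size * 2 := by
  rw [← Nat.size_eq_bits_len]
  exact length_listCode_le fun b _ => le_rfl

/-- The code of a list of rows of natural numbers. -/
def tableCode : List (List ℕ) → List Bool := listCode (listCode natCode)

lemma tableCode_injective : Function.Injective tableCode :=
  isPrefixCode_natCode.listCode.listCode.injective

lemma length_tableCode_le {L : List (List ℕ)} {k N : ℕ}
    (hL : ∀ row ∈ L, row.length ≤ k ∧ ∀ x ∈ row, x ≤ N) :
    (tableCode L).length ≤ 1 + L.length * (k * (2 + N.size * 2) + 2) := by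
  refine (length_listCode_le (B := 1 + k * (2 + N.size * 2)) fun row hrow => ?_).trans
    (by apply le_of_eq; ring)
  refine (length_listCode_le (B := 1 + N.size * 2) fun x hx => ?_).trans ?_
  · refine (length_natCode_le x).trans ?_
    have := Nat.size_le_size ((hL row hrow).2 x hx)
    omega
  · have := Nat.mul_le_mul_right (1 + N.size * 2 + 1) (hL row hrow).1
    have h : k * (1 + N.size * 2 + 1) = k * (2 + N.size * 2) := by ring
    omega

/-! ### Encoding the distances -/

/-- The indicator at `t` of the cyclic interval given by `b`, `lo` and `hi`: for `b = 0` this is the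
interval `[lo, hi)`, and for `b = 1` it is the complement. -/
def cyclicIndicator (b lo hi t : ℕ) : ℕ := if lo ≤ t ∧ t < hi then 1 - b else b

lemma NonAlternating.exists_cyclicIndicator {N : ℕ} {P : ℕ → Prop} [DecidablePred P]
    (hP : NonAlternating N P) : ∃ b lo hi, b ≤ 1 ∧ lo ≤ N ∧ hi ≤ N ∧
      ∀ t < N, cyclicIndicator b lo hi t = if P t then 1 else 0 := by
  obtain ⟨lo, hi, hlo, hhi, h⟩ := hP.exists_interval
  refine ⟨if P 0 then 1 else 0, lo, hi, by split_ifs <;> omega, hlo, hhi, fun t ht => ?_⟩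
  have := h t ht
  unfold cyclicIndicator
  split_ifs <;> first | rfl | (exfalso; tauto)

/-- Every vertex map `q` of a connected graph yields a tree on the values of `q`. Each value `b` has
a representative `ρ b`; this is the root `r`, or it has a neighbor whose value has smaller rank
than `b`. The representatives are the vertices closest to the root. -/
lemma SimpleGraph.Connected.exists_representatives {V β : Type*} {G : SimpleGraph V}
    (hG : G.Connected) (q : V → β) (r : V) :
    ∃ (ρ : β → V) (rank : β → ℕ), ∀ v, q (ρ (q v)) = q v ∧
      (ρ (q v) = r ∨ ∃ w, G.Adj (ρ (q v)) w ∧ rank (q w) < rank (q v)) := by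
  set rank : β → ℕ := fun b => sInf {m | ∃ v, q v = b ∧ G.dist v r = m} with hrank
  have hρ : ∀ b, ∃ x, (∃ v, q v = b) → q x = b ∧ G.dist x r = rank b := fun b => by
    by_cases h : ∃ v, q v = b
    · obtain ⟨v, hv⟩ := h
      obtain ⟨x, hx⟩ := Nat.sInf_mem (s := {m | ∃ v, q v = b ∧ G.dist v r = m}) ⟨_, v, hv, rfl⟩
      exact ⟨x, fun _ => hx⟩
    · exact ⟨r, fun h' => absurd h' h⟩
  choose ρ hρ using hρ
  refine ⟨ρ, rank, fun v => ?_⟩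
  obtain ⟨h1, h2⟩ := hρ (q v) ⟨v, rfl⟩
  refine ⟨h1, ?_⟩
  obtain ⟨p, hp⟩ := hG.exists_walk_length_eq_dist (ρ (q v)) r
  rw [← h2, ← hp]
  generalize ρ (q v) = x at p
  cases p with
  | nil => exact Or.inl rfl
  | @cons _ w _ hadj p =>
    refine Or.inr ⟨w, hadj, ?_⟩
    have h3 : rank (q w) ≤ G.dist w r := Nat.sInf_le ⟨w, rfl, rfl⟩
    have h4 := SimpleGraph.dist_le p
    rw [SimpleGraph.Walk.length_cons]
    omega

/-- A distance table `g` (with entries `g v s`) satisfies the constraints in the rows of `L`.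
A row `[s, i]` says that `s` has position `i`. A row `[r, s, x]` gives the entry `x` at `r` and `s`.
A row of length eight gives the differences between the rows of `v` and `p` of the table; they are
`-1`, `0` or `1`, and are given by the cyclic intervals of positions where they are at most `0`,
and at most `-1`. -/
def IsConsistent (L : List (List ℕ)) (g : ℕ → ℕ → ℕ) : Prop :=
  (∀ r s x, [r, s, x] ∈ L → g r s = x) ∧
  ∀ v p b lo hi b' lo' hi', [v, p, b, lo, hi, b', lo', hi'] ∈ L → ∀ s i, [s, i] ∈ L →
    g v s + cyclicIndicator b lo hi i + cyclicIndicator b' lo' hi' i = g p s + 1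

/-- The decoding function: it recovers the list of constraints, and reads the entry off a table
that satisfies them. -/
noncomputable def decodeDist (code : List Bool) (s t : ℕ) : ℕ :=
  Classical.epsilon (IsConsistent (Function.invFun tableCode code)) t s

namespace RotationSystem

open SimpleGraph

variable {V : Type*} {G : SimpleGraph V}

/-- The difference of the distances from two equal or adjacent vertices is given on a face by
two cyclic intervals. -/
lemma IsPlanar.exists_cyclicIndicator_dist [Finite V] {R : RotationSystem G} (hR : R.IsPlanar)
    (hG : G.Connected) (d : G.Dart) {v w : V} (hvw : v = w ∨ G.Adj v w) :
    ∃ b lo hi b' lo' hi', b ≤ 1 ∧ lo ≤ Function.minimalPeriod R.faceNext d ∧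
      hi ≤ Function.minimalPeriod R.faceNext d ∧ b' ≤ 1 ∧
      lo' ≤ Function.minimalPeriod R.faceNext d ∧ hi' ≤ Function.minimalPeriod R.faceNext d ∧
      ∀ t < Function.minimalPeriod R.faceNext d,
        G.dist v (R.faceWalk d t) + cyclicIndicator b lo hi t + cyclicIndicator b' lo' hi' t =
          G.dist w (R.faceWalk d t) + 1 := by
  obtain ⟨b, lo, hi, hb, hlo, hhi, h⟩ :=
    (hR.nonAlternating_dist_sub_dist hG d v w 0).exists_cyclicIndicator
  obtain ⟨b', lo', hi', hb', hlo', hhi', h'⟩ :=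
    (hR.nonAlternating_dist_sub_dist hG d v w (-1)).exists_cyclicIndicator
  refine ⟨b, lo, hi, b', lo', hi', hb, hlo, hhi, hb', hlo', hhi', fun t ht => ?_⟩
  rw [h t ht, h' t ht]
  rcases hvw with rfl | hvw
  · simp
  · have := hvw.diff_dist_adj (u := R.faceWalk d t)
    rw [dist_comm (v := v), dist_comm (v := w)] at this
    split_ifs <;> omega

lemma minimalPeriod_faceNext_le [Finite V] (R : RotationSystem G) (d : G.Dart) :
    Function.minimalPeriod R.faceNext d ≤ Nat.card V ^ 2 := by
  classical
  have := Fintype.ofFinite V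
  have h := Finset.card_le_card_of_injOn (s := Finset.range (Function.minimalPeriod R.faceNext d))
    (t := (Finset.univ : Finset (V × V))) (fun t => ((R.faceNext ^ t) d).toProd)
    (fun _ _ => Finset.mem_univ _) (fun s hs t ht hst => R.faceNext_pow_injOn d
      (by simpa using hs) (by simpa using ht) (Dart.toProd_injective hst))
  rw [Finset.card_range, Finset.card_univ, Fintype.card_prod] at h
  rw [Nat.card_eq_fintype_card, sq]
  exact h

/-- The distances between `S` and `T` are determined by a list of one constraint for every distance
tuple and for every element of `T`, and of two constraints for every element of `S`. The tuples form
a tree in which neighbors are tuples of adjacent vertices. -/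
theorem IsPlanar.exists_table {n : ℕ} (hn : 2 ≤ n) {G : SimpleGraph (Fin n)}
    {R : RotationSystem G} (hR : R.IsPlanar) (hG : G.Connected) {S : Finset (Fin n)}
    (hS : R.ConsecutiveOnFace S) (T : Finset (Fin n)) :
    ∃ L : List (List ℕ),
      L.length ≤ 2 * S.card + (Set.range (distTuple G S)).ncard + T.card ∧
      (∀ row ∈ L, row.length ≤ 8 ∧ ∀ x ∈ row, x ≤ n ^ 2) ∧
      (∃ g, IsConsistent L g) ∧
      ∀ g, IsConsistent L g → ∀ s ∈ S, ∀ t ∈ T, g t s = G.dist s t := by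
  classical
  obtain ⟨d, ℓ, hℓ⟩ := hS
  have hvisit : ∀ s ∈ S, ∃ t, R.faceWalk d t = s := fun s hs => by
    obtain ⟨t, -, ht⟩ := (hℓ s).1 hs
    exact ⟨t, ht⟩
  have hnn : n ≤ n ^ 2 := Nat.le_self_pow (by norm_num) n
  have hper := R.minimalPeriod_faceNext_le d
  rw [Nat.card_fin] at hper
  set r : Fin n := ⟨0, by omega⟩
  set q := distTuple G S with hq
  have hq_eq : ∀ {v w}, q v = q w → ∀ s ∈ S, G.dist v s = G.dist w s := fun h s hs => by
    rw [dist_comm, dist_comm (v := s)]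
    exact congrFun h ⟨s, hs⟩
  obtain ⟨ρ, rank, hρ⟩ := hG.exists_representatives q r
  -- the parent of a tuple in the tree; the root is its own parent
  have hpar : ∀ b, ∃ w, b ∈ Set.range q → (ρ b = r ∧ ρ b = w) ∨
      (G.Adj (ρ b) w ∧ rank (q w) < rank b) := fun b => by
    by_cases hb : b ∈ Set.range q
    · obtain ⟨v, rfl⟩ := hb
      rcases (hρ v).2 with h | ⟨w, hw⟩
      · exact ⟨ρ (q v), fun _ => Or.inl ⟨h, rfl⟩⟩
      · exact ⟨w, fun _ => Or.inr hw⟩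
    · exact ⟨r, fun h => absurd h hb⟩
  choose par hpar using hpar
  set Q : Finset ({s // s ∈ S} → ℕ) := Finset.univ.image q
  -- an element of `T` is treated as a child of the representative of its tuple, with the same tuple
  set E : List (Fin n × Fin n) := Q.toList.map (fun b => (ρ b, ρ (q (par b)))) ++
    T.toList.map (fun t => (t, ρ (q t)))
  have hE : ∀ e ∈ E, ∃ w, (e.1 = w ∨ G.Adj e.1 w) ∧ q w = q e.2 := by
    intro e he
    rcases List.mem_append.1 he with he | he
    · obtain ⟨b, hb, rfl⟩ := List.mem_map.1 he
      obtain ⟨v, -, rfl⟩ := Finset.mem_image.1 (Finset.mem_toList.1 hb)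
      refine ⟨par (q v), ?_, ((hρ _).1).symm⟩
      exact (hpar _ ⟨v, rfl⟩).imp And.right And.left
    · obtain ⟨t, -, rfl⟩ := List.mem_map.1 he
      exact ⟨t, Or.inl rfl, ((hρ _).1).symm⟩
  have hrow : ∀ e ∈ E, ∃ b lo hi b' lo' hi', (b ≤ n ^ 2 ∧ lo ≤ n ^ 2 ∧ hi ≤ n ^ 2 ∧
      b' ≤ n ^ 2 ∧ lo' ≤ n ^ 2 ∧ hi' ≤ n ^ 2) ∧ ∀ s ∈ S,
        G.dist e.1 s + cyclicIndicator b lo hi (R.firstVisit d s) +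
          cyclicIndicator b' lo' hi' (R.firstVisit d s) = G.dist e.2 s + 1 := by
    intro e he
    obtain ⟨w, hw, hqw⟩ := hE e he
    obtain ⟨b, lo, hi, b', lo', hi', h1, h2, h3, h4, h5, h6, h⟩ :=
      hR.exists_cyclicIndicator_dist hG d hw
    refine ⟨b, lo, hi, b', lo', hi', ⟨by omega, by omega, by omega, by omega, by omega, by omega⟩,
      fun s hs => ?_⟩
    have := h _ (R.firstVisit_lt d (hvisit s hs))
    rwa [R.faceWalk_firstVisit d (hvisit s hs), hq_eq hqw s hs] at this
  choose! b lo hi b' lo' hi' hbound hdist using hrow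
  set L : List (List ℕ) := S.toList.map (fun s => [s.val, R.firstVisit d s]) ++
    S.toList.map (fun s => [r.val, s.val, G.dist r s]) ++
    E.map (fun e => [e.1.val, e.2.val, b e, lo e, hi e, b' e, lo' e, hi' e]) with hL
  have hpos : ∀ s i, [s, i] ∈ L ↔ ∃ v ∈ S, v.val = s ∧ R.firstVisit d v = i := fun s i => by
    simp [hL]
  have hroot : ∀ v s x, [v, s, x] ∈ L ↔ ∃ w ∈ S, r.val = v ∧ w.val = s ∧ G.dist r w = x :=
    fun v s x => by simp [hL]
  have hedge : ∀ v p c l h c' l' h', [v, p, c, l, h, c', l', h'] ∈ L ↔ ∃ e ∈ E, e.1.val = v ∧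
      e.2.val = p ∧ b e = c ∧ lo e = l ∧ hi e = h ∧ b' e = c' ∧ lo' e = l' ∧ hi' e = h' :=
    fun v p c l h c' l' h' => by simp [hL]
  refine ⟨L, ?_, ?_, ?_, ?_⟩
  · have hQ : Q.card = (Set.range q).ncard := by
      rw [← Set.ncard_coe_finset, Finset.coe_image, Finset.coe_univ, Set.image_univ]
    simp only [hL, E, List.length_append, List.length_map, Finset.length_toList, hQ]
    omega
  · have hfin : ∀ v : Fin n, v.val ≤ n ^ 2 := fun v => by have := v.2; omega
    intro row hrow
    rcases List.mem_append.1 hrow with hrow | hrow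
    · rcases List.mem_append.1 hrow with hrow | hrow
      · obtain ⟨s, hs, rfl⟩ := List.mem_map.1 hrow
        have := R.firstVisit_lt d (hvisit s (Finset.mem_toList.1 hs))
        have := hfin s
        simp
        omega
      · obtain ⟨s, hs, rfl⟩ := List.mem_map.1 hrow
        obtain ⟨p, hp, hp'⟩ := hG.exists_path_of_dist r s
        have := hp.length_lt
        rw [Fintype.card_fin] at this
        have := hfin s
        have := hfin r
        simp
        omega
    · obtain ⟨e, he, rfl⟩ := List.mem_map.1 hrow
      have := hbound e he
      have := hfin e.1
      have := hfin e.2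
      simp
      omega
  · refine ⟨fun v s => if h : v < n ∧ s < n then G.dist ⟨v, h.1⟩ ⟨s, h.2⟩ else 0, ?_, ?_⟩
    · intro v s x h
      obtain ⟨w, -, rfl, rfl, rfl⟩ := (hroot _ _ _).1 h
      simp
    · intro v p c l h c' l' h' hmem s i hs
      obtain ⟨e, he, rfl, rfl, rfl, rfl, rfl, rfl, rfl, rfl⟩ := (hedge _ _ _ _ _ _ _ _).1 hmem
      obtain ⟨w, hw, rfl, rfl⟩ := (hpos _ _).1 hs
      simpa using hdist e he w hw
  · intro g hg
    -- along an edge of the tree, correctness passes from the parent to the child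
    have hstep : ∀ e ∈ E, ∀ s ∈ S, g e.2 s = G.dist e.2 s → g e.1 s = G.dist e.1 s :=
      fun e he s hs h => by
        have h1 := hg.2 _ _ _ _ _ _ _ _
          ((hedge _ _ _ _ _ _ _ _).2 ⟨e, he, rfl, rfl, rfl, rfl, rfl, rfl, rfl, rfl⟩) s _
          ((hpos _ _).2 ⟨s, hs, rfl, rfl⟩)
        have h2 := hdist e he s hs
        omega
    have hrep : ∀ k v, rank (q v) = k → ∀ s ∈ S, g (ρ (q v)) s = G.dist (ρ (q v)) s := by
      intro k
      induction k using Nat.strong_induction_on with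
      | _ k ih =>
        rintro v rfl s hs
        rcases hpar (q v) ⟨v, rfl⟩ with ⟨h, -⟩ | ⟨-, h⟩
        · rw [h]
          exact hg.1 _ _ _ ((hroot _ _ _).2 ⟨s, hs, rfl, rfl, rfl⟩)
        · refine hstep (ρ (q v), ρ (q (par (q v)))) (List.mem_append_left _ (List.mem_map.2
            ⟨q v, Finset.mem_toList.2 (Finset.mem_image_of_mem _ (Finset.mem_univ _)), rfl⟩)) s hs
            (ih _ h _ rfl s hs)
    intro s hs t ht
    rw [dist_comm]
    exact hstep (t, ρ (q t)) (List.mem_append_right _ (List.mem_map.2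
      ⟨t, Finset.mem_toList.2 ht, rfl⟩)) s hs (hrep _ t rfl s hs)

end RotationSystem

lemma size_sq_le_log {n : ℕ} (hn : 2 ≤ n) : ((n ^ 2).size : ℝ) ≤ 5 * Real.log n := by
  have hlog2 := Real.log_two_gt_d9
  have hlogn : Real.log 2 ≤ Real.log n :=
    Real.log_le_log (by norm_num) (by exact_mod_cast hn)
  have h : 2 ^ ((n ^ 2).size - 1) ≤ n ^ 2 :=
    Nat.lt_size.1 (Nat.sub_lt (Nat.size_pos.2 (by positivity)) one_pos)
  have h' : (((n ^ 2).size - 1 : ℕ) : ℝ) * Real.log 2 ≤ 2 * Real.log n := by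
    have := Real.log_le_log (by positivity) (show (2 : ℝ) ^ ((n ^ 2).size - 1) ≤ (n : ℝ) ^ 2 by
      exact_mod_cast h)
    rw [Real.log_pow, Real.log_pow] at this
    exact_mod_cast this
  have hsub : ((n ^ 2).size : ℝ) ≤ (((n ^ 2).size - 1 : ℕ) : ℝ) + 1 := by
    exact_mod_cast Nat.le_add_of_sub_le le_rfl
  have hnn : (0 : ℝ) ≤ (((n ^ 2).size - 1 : ℕ) : ℝ) := Nat.cast_nonneg _
  nlinarith

namespace RotationSystem

/-- All distances between `S` and `T` can be encoded in `O((|S| ^ 3 D + |T|) log n)` bits. -/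
theorem IsPlanar.exists_code {n : ℕ} (hn : 2 ≤ n) {G : SimpleGraph (Fin n)}
    {R : RotationSystem G} (hR : R.IsPlanar) (hG : G.Connected) {S : Finset (Fin n)}
    (hne : S.Nonempty) (hS : R.ConsecutiveOnFace S) (T : Finset (Fin n)) :
    ∃ code : List Bool,
      (code.length : ℝ) ≤
        8000 * ((S.card : ℝ) ^ 3 * (G.diam : ℝ) + (T.card : ℝ)) * Real.log (n : ℝ) ^ 1 ∧
      ∀ s ∈ S, ∀ t ∈ T, decodeDist code s t = G.dist s t := by
  obtain ⟨L, hlen, hrow, hex, huniq⟩ := hR.exists_table hn hG hS T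
  refine ⟨tableCode L, ?_, fun s hs t ht => ?_⟩
  · have : Nontrivial (Fin n) := Fin.nontrivial_iff_two_le.2 hn
    have hcount := hR.ncard_range_distTuple_le hG hne hS
    have hdiam : 1 ≤ G.diam :=
      Nat.one_le_iff_ne_zero.2 (SimpleGraph.connected_iff_diam_ne_zero.1 hG)
    have hSpos : 1 ≤ S.card := hne.card_pos
    set X := S.card ^ 3 * G.diam + T.card with hX
    have hSX : S.card ≤ S.card ^ 3 * G.diam :=
      (Nat.le_self_pow (by norm_num) _).trans (Nat.le_mul_of_pos_right _ hdiam)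
    have hLX : L.length ≤ 66 * X := by
      have : 64 * S.card ^ 3 * G.diam = 64 * (S.card ^ 3 * G.diam) := by ring
      omega
    have hX1 : 1 ≤ X := by omega
    have hcode : (tableCode L).length ≤ X * (1189 + 1056 * (n ^ 2).size) := by
      calc (tableCode L).length ≤ 1 + L.length * (8 * (2 + (n ^ 2).size * 2) + 2) :=
            length_tableCode_le hrow
        _ ≤ X + 66 * X * (8 * (2 + (n ^ 2).size * 2) + 2) :=
            add_le_add hX1 (Nat.mul_le_mul_right _ hLX)
        _ = X * (1189 + 1056 * (n ^ 2).size) := by ring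
    have hlog : (1 : ℝ) ≤ 2 * Real.log n := by
      have := Real.log_two_gt_d9
      have : Real.log 2 ≤ Real.log n := Real.log_le_log (by norm_num) (by exact_mod_cast hn)
      linarith
    have hsize := size_sq_le_log hn
    calc ((tableCode L).length : ℝ) ≤ X * (1189 + 1056 * (n ^ 2).size) := by exact_mod_cast hcode
      _ ≤ X * (8000 * Real.log n) :=
          mul_le_mul_of_nonneg_left (by linarith) (Nat.cast_nonneg _)
      _ = _ := by rw [hX]; push_cast; ring
  · have hinv : Function.invFun tableCode (tableCode L) = L :=
      Function.leftInverse_invFun tableCode_injective L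
    rw [decodeDist, hinv]
    exact huniq _ (Classical.epsilon_spec hex) s hs t ht

end RotationSystem

theorem mainTheorem1 :
    (∃ C : ℕ, ∀ (V : Type*) [Finite V] [Nontrivial V] (G : SimpleGraph V), G.Connected →
      ∀ R : RotationSystem G, R.IsPlanar →
      ∀ S : Finset V, S.Nonempty → R.ConsecutiveOnFace S →
        (Set.range (distTuple G S)).ncard ≤ C * S.card ^ 3 * G.diam) ∧
    (∃ (decode : List Bool → ℕ → ℕ → ℕ) (C : ℝ) (k : ℕ),
      ∀ (n : ℕ), 2 ≤ n → ∀ G : SimpleGraph (Fin n), G.Connected →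
      ∀ R : RotationSystem G, R.IsPlanar →
      ∀ S : Finset (Fin n), S.Nonempty → R.ConsecutiveOnFace S →
      ∀ T : Finset (Fin n), ∃ code : List Bool,
        (code.length : ℝ) ≤
          C * ((S.card : ℝ) ^ 3 * (G.diam : ℝ) + (T.card : ℝ)) * Real.log (n : ℝ) ^ k ∧
        ∀ s ∈ S, ∀ t ∈ T, decode code s t = G.dist s t) :=
  ⟨⟨64, fun _ _ _ _ hG _ hR _ hne hS => hR.ncard_range_distTuple_le hG hne hS⟩,
    decodeDist, 8000, 1, fun _ hn _ hG _ hR _ hne hS T => hR.exists_code hn hG hne hS T⟩
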